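/- Let $X_1, X_2, \ldots$ be independent identically distributed real random variables, each distributed as a random variable $X$. Let $m, K$ be fixed and let $f_1, \ldots, f_m : \mathbb R \to \mathbb R$ be Borel measurable functions with $\mathbb E[f_i(X)^4] < \infty$ for all $i$. For functions $f, g$ among $f_1, \ldots, f_m$ put $$C(f,g) := \frac{\mathrm{Cov}(f(X), g(X))}{s(f)\,s(g)}, \qquad s(f) := \sqrt{\mathrm{Var}(f(X))},$$ and, for $N > k \ge 1$, $$\hat m(f) := \frac1N \sum_{i=1}^N f(X_i), \qquad \hat s^2(f) := \frac1N \sum_{i=1}^N \bigl(f(X_i) - \hat m(f)\bigr)^2,$$ $$\hat\gamma_k(f,g) := \frac{1}{N-k} \sum_{i=1}^{N-k} \bigl(f(X_i) - \hat m(f)\bigr)\bigl(g(X_{i+k}) - \hat m(g)\bigr), \qquad \hat\rho_k(f,g) := \frac{\hat\gamma_k(f,g)}{\hat s(f)\,\hat s(g)},$$ where a ratio with denominator $0$ is read as $0$. (For $N \le k$ set $\hat\rho_k(f,g) := 0$.) Let $\hat{\mathbb C}_k := [\hat\rho_k(f_i, f_j)]_{i,j=1,\ldots,m} \in \mathbb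 R^{m^2}$ for $k = 1, \ldots, K$, and let $\mathbf C$ be the $m^2 \times m^2$ matrix with entries $$\mathbf C_{(ij),(i'j')} := C(f_i, f_{i'})\, C(f_j, f_{j'}).$$ Then $\mathbf C$ is positive semidefinite (so that it is a covariance matrix) and, as $N \to \infty$, jointly in distribution, $$N^{1/2}\bigl[\hat{\mathbb C}_1, \ldots, \hat{\mathbb C}_K\bigr] \Rightarrow (\tilde\Xi_1, \ldots, \tilde\Xi_K), \qquad \tilde\Xi_k \sim N_{m^2}(\mathbf 0, \mathbf C) \text{ independent and identically distributed}.$$ -/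

import Mathlib

open MeasureTheory ProbabilityTheory Filter Topology

namespace IIDTest

noncomputable section

/-! ### Population quantities of a random variable `X` -/

section Population

variable {Ω : Type*} [MeasurableSpace Ω]

/-- `Q(f, g) = Cov(f(X), g(X))`. -/
def crossCov (X : Ω → ℝ) (P : Measure Ω) (f g : ℝ → ℝ) : ℝ :=
  cov[fun ω => f (X ω), fun ω => g (X ω); P]

/-- `s(f) = Var(f(X))^{1/2}`. -/
def stdDev (X : Ω → ℝ) (P : Measure Ω) (f : ℝ → ℝ) : ℝ :=
  √(Var[fun ω => f (X ω); P])

/-- `C(f, g) = Q(f, g) / (s(f) s(g))`. -/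
def crossCorr (X : Ω → ℝ) (P : Measure Ω) (f g : ℝ → ℝ) : ℝ :=
  crossCov X P f g / (stdDev X P f * stdDev X P g)

/-- The matrix with entries `C(f_i, f_{i'}) C(f_j, f_{j'})` in row `(i, j)`, column `(i', j')`. -/
def limitCorrMatrix (X : Ω → ℝ) (P : Measure Ω) {m : ℕ} (f : Fin m → ℝ → ℝ) :
    Matrix (Fin m × Fin m) (Fin m × Fin m) ℝ :=
  Matrix.of fun p q => crossCorr X P (f p.1) (f q.1) * crossCorr X P (f p.2) (f q.2)

end Population

/-! ### Empirical quantities of the first `N` terms of a real sequence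

The terms `x_1, x_2, …` are stored as `x 0, x 1, …`. -/

/-- Empirical mean of `f(x_1), …, f(x_N)`. -/
def empMean (x : ℕ → ℝ) (N : ℕ) (f : ℝ → ℝ) : ℝ :=
  (1 / (N : ℝ)) * ∑ i ∈ Finset.range N, f (x i)

/-- Empirical variance of `f(x_1), …, f(x_N)`, normalized by `1 / N`. -/
def empVar (x : ℕ → ℝ) (N : ℕ) (f : ℝ → ℝ) : ℝ :=
  (1 / (N : ℝ)) * ∑ i ∈ Finset.range N, (f (x i) - empMean x N f) ^ 2

/-- Empirical standard deviation. -/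
def empStdDev (x : ℕ → ℝ) (N : ℕ) (f : ℝ → ℝ) : ℝ :=
  √(empVar x N f)

/-- Empirical cross-covariance with time lag `k`, normalized by `1 / (N - k)`
(the sum is empty for `N ≤ k`). -/
def empCrossCov (x : ℕ → ℝ) (N k : ℕ) (f g : ℝ → ℝ) : ℝ :=
  (1 / ((N : ℝ) - (k : ℝ))) *
    ∑ i ∈ Finset.range (N - k), (f (x i) - empMean x N f) * (g (x (i + k)) - empMean x N g)

/-- Empirical cross-correlation with time lag `k`. -/
def empCrossCorr (x : ℕ → ℝ) (N k : ℕ) (f g : ℝ → ℝ) : ℝ :=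
  empCrossCov x N k f g / (empStdDev x N f * empStdDev x N g)

/-- The vector of all empirical auto- and cross-correlations with time lag `k`. -/
def empCorrVector (x : ℕ → ℝ) (N k : ℕ) {m : ℕ} (f : Fin m → ℝ → ℝ) :
    EuclideanSpace ℝ (Fin m × Fin m) :=
  WithLp.toLp 2 fun p => empCrossCorr x N k (f p.1) (f p.2)

end

end IIDTest

/-!
Correlations are unchanged by standardization, so each `f i` is replaced by
`φ i = (f i - E f i(X)) / s(f i)`, which vanishes when `f i(X)` is almost surely constant
(`empCrossCorr_eq_of_affine`, `standardize`).

For centred square integrable `φ i` the empirical means are `O(N ^ (-1/2))` in `L²`. Hence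
`√N γ̂_k(φ i, φ j)` differs from the sum `N ^ (-1/2) ∑ φ i(X_n) φ j(X_{n+k})` of lagged products
by a term that tends to zero in `L¹` (`tendsto_integral_abs_sqrt_mul_empCrossCov_sub`). The
empirical variances converge almost surely, to `1` in the nondegenerate case
(`ae_tendsto_empVar`), so by Slutsky's theorem the empirical correlations have the same limit in
distribution as these sums.

The lagged products are centred, uncorrelated at different times `n` because the earliest time
occurs only once, uncorrelated for different lags for a similar reason, and for a common lag their
covariance is `C(f i, f i') C(f j, f j')`. The limit law of their sums is found with Lévy's
continuity theorem (`tendstoInDistribution_lagProd_sum`): a linear combination of the lagged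
products is a function `Z n` of the window `X_n, …, X_{n+K}`, and the characteristic function of
`N ^ (-1/2) ∑ Z n` converges to a Gaussian one (`tendsto_charFun_window_sum`). For the latter, the
times are cut into blocks of length `L + K'`, where `K'` is the window length, and only the first
`L` windows of each block are kept. The block sums are i.i.d., so the classical central limit
theorem applies to them, and by orthogonality the discarded terms carry a proportion of the
variance of about `K' / (L + K')`, which is negligible as `L → ∞`.

All of this needs only second moments of the `f i(X)`, which follow from the fourth moments.
-/

namespace IIDTest

/-! ### Orthogonal sums and characteristic functions -/

section Orthogonal

variable {Ω : Type*} [MeasurableSpace Ω] {P : Measure Ω}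

/-- The blocks of an independent family indexed by a product are independent. -/
lemma iIndepFun_curry {ι κ E : Type*} [Countable ι] [Countable κ] [MeasurableSpace E]
    {X : ι × κ → Ω → E} (hX : ∀ p, AEMeasurable (X p) P) (h : iIndepFun X P) :
    iIndepFun (fun i ω j => X (i, j) ω) P := by
  have := h.isProbabilityMeasure
  have _ p := Measure.isProbabilityMeasure_map (hX p)
  have hrow (i : ι) : P.map (fun ω j => X (i, j) ω)
      = Measure.infinitePi fun j => P.map (X (i, j)) :=
    (h.precomp (g := fun j => (i, j)) fun a b hab => (Prod.mk.inj hab).2)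
      |>.map_fun_eq_infinitePi_map₀' fun j => hX (i, j)
  rw [iIndepFun_iff_map_fun_eq_infinitePi_map₀'
    fun i => aemeasurable_pi_lambda _ fun j => hX (i, j)]
  simp_rw [hrow]
  rw [← Measure.infinitePi_map_curry (μ := fun i j => P.map (X (i, j))),
    ← h.map_fun_eq_infinitePi_map₀' hX,
    AEMeasurable.map_map_of_aemeasurable (by fun_prop) (aemeasurable_pi_lambda _ hX)]
  rfl

lemma integral_abs_le_sqrt_integral_sq [IsProbabilityMeasure P] {X : Ω → ℝ} (hX : MemLp X 2 P) :
    ∫ ω, |X ω| ∂P ≤ √(∫ ω, X ω ^ 2 ∂P) := by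
  have h := variance_nonneg |X| P
  rw [variance_eq_sub hX.abs] at h
  refine Real.le_sqrt_of_sq_le ?_
  simp only [Pi.pow_apply, Pi.abs_apply, sq_abs] at h
  linarith

/-- Pythagoras for a sequence of orthogonal random variables of common second moment. -/
lemma integral_sq_sum_eq_card_mul {Z : ℕ → Ω → ℝ} (hZ : ∀ n, MemLp (Z n) 2 P) {v : ℝ}
    (hv : ∀ n, ∫ ω, Z n ω ^ 2 ∂P = v) (horth : ∀ n n', n < n' → ∫ ω, Z n ω * Z n' ω ∂P = 0)
    (s : Finset ℕ) : ∫ ω, (∑ n ∈ s, Z n ω) ^ 2 ∂P = s.card * v := by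
  have hint (i j : ℕ) : Integrable (fun ω => Z i ω * Z j ω) P := (hZ i).integrable_mul (hZ j)
  have hij (i j : ℕ) : ∫ ω, Z i ω * Z j ω ∂P = if i = j then v else 0 := by
    rcases lt_trichotomy i j with h | h | h
    · rw [if_neg h.ne, horth i j h]
    · subst h
      rw [if_pos rfl, ← hv i]
      simp_rw [pow_two]
    · rw [if_neg h.ne', ← horth j i h]
      simp_rw [mul_comm]
  simp_rw [pow_two, Finset.sum_mul_sum]
  rw [integral_finsetSum _ fun i _ => integrable_finsetSum _ fun j _ => hint i j]
  simp_rw [integral_finsetSum _ fun j _ => hint _ j, hij]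
  simp

lemma integral_abs_sum_le [IsProbabilityMeasure P] {Z : ℕ → Ω → ℝ} (hZ : ∀ n, MemLp (Z n) 2 P)
    {v : ℝ} (hv : ∀ n, ∫ ω, Z n ω ^ 2 ∂P = v)
    (horth : ∀ n n', n < n' → ∫ ω, Z n ω * Z n' ω ∂P = 0) (s : Finset ℕ) :
    ∫ ω, |∑ n ∈ s, Z n ω| ∂P ≤ √(s.card * v) := by
  rw [← integral_sq_sum_eq_card_mul hZ hv horth s]
  exact integral_abs_le_sqrt_integral_sq (memLp_finsetSum _ fun n _ => hZ n)

/-- Characteristic functions are Lipschitz for the `L¹` distance of the random variables. -/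
lemma norm_charFun_map_sub_le [IsProbabilityMeasure P] {X Y : Ω → ℝ} (hX : Integrable X P)
    (hY : Integrable Y P) (t : ℝ) :
    ‖charFun (P.map X) t - charFun (P.map Y) t‖ ≤ |t| * ∫ ω, |X ω - Y ω| ∂P := by
  have hchar {W : Ω → ℝ} (hW : AEMeasurable W P) :
      charFun (P.map W) t = ∫ ω, Complex.exp (t * W ω * Complex.I) ∂P := by
    rw [charFun_apply_real, integral_map hW (by fun_prop)]
  have hint {W : Ω → ℝ} (hW : AEMeasurable W P) :
      Integrable (fun ω => Complex.exp (t * W ω * Complex.I)) P := by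
    refine Integrable.of_bound (C := 1) (by fun_prop) (ae_of_all _ fun ω => ?_)
    rw [← Complex.ofReal_mul, Complex.norm_exp_ofReal_mul_I]
  rw [hchar hX.aemeasurable, hchar hY.aemeasurable,
    ← integral_sub (hint hX.aemeasurable) (hint hY.aemeasurable), ← integral_const_mul]
  refine norm_integral_le_of_norm_le ((hX.sub hY).abs.const_mul _) (ae_of_all _ fun ω => ?_)
  have hfac : Complex.exp (t * X ω * Complex.I) - Complex.exp (t * Y ω * Complex.I)
      = Complex.exp (((t * Y ω : ℝ) : ℂ) * Complex.I)
        * (Complex.exp (Complex.I * ((t * (X ω - Y ω) : ℝ) : ℂ)) - 1) := by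
    rw [mul_sub, ← Complex.exp_add, mul_one]
    push_cast
    ring_nf
  rw [hfac, norm_mul, Complex.norm_exp_ofReal_mul_I, one_mul]
  refine Real.norm_exp_I_mul_ofReal_sub_one_le.trans ?_
  simp

end Orthogonal

/-- Interchange of limits: `a` converges to `α` if it is approximated, within an eventual error
that vanishes as `L → ∞`, by sequences `b L` whose limits converge to `α`. -/
lemma tendsto_of_approx {a : ℕ → ℂ} {b : ℕ → ℕ → ℂ} {β : ℕ → ℂ} {α : ℂ} {r : ℕ → ℕ → ℝ}
    {δ : ℕ → ℝ} (hb : ∀ L, Tendsto (b L) atTop (𝓝 (β L))) (hβ : Tendsto β atTop (𝓝 α))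
    (hr : ∀ L, Tendsto (r L) atTop (𝓝 (δ L))) (hδ : Tendsto δ atTop (𝓝 0))
    (hab : ∀ L n, ‖a n - b L n‖ ≤ r L n) : Tendsto a atTop (𝓝 α) := by
  rw [Metric.tendsto_atTop']
  intro ε hε
  obtain ⟨L, hL₁, hL₂⟩ := ((hδ.eventually_lt_const (show 0 < ε / 3 by positivity)).and
    (Metric.tendsto_nhds.1 hβ (ε / 3) (by positivity))).exists
  obtain ⟨n₀, hn₀⟩ := eventually_atTop.1 (((hr L).eventually_lt_const hL₁).and
    (Metric.tendsto_nhds.1 (hb L) (ε / 3) (by positivity)))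
  refine ⟨n₀, fun n hn => ?_⟩
  have h₁ := (hn₀ n hn.le).1
  have h₂ := (hn₀ n hn.le).2
  have h₃ : dist (a n) (b L n) < ε / 3 := by
    rw [dist_eq_norm]
    exact (hab L n).trans_lt h₁
  have := dist_triangle4 (a n) (b L n) (β L) α
  linarith

/-! ### A central limit theorem for functions of a moving window -/

section Window

variable {Ω E : Type*} [MeasurableSpace Ω] [MeasurableSpace E] {P : Measure Ω}
  {ξ : ℕ → Ω → E}

lemma tendsto_natDiv_div (B : ℕ) :
    Tendsto (fun n : ℕ => ((n / B : ℕ) : ℝ) / n) atTop (𝓝 (1 / B)) := by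
  have h := (tendsto_nat_floor_mul_div_atTop (R := ℝ) (a := 1 / (B : ℝ)) (by positivity)).comp
    tendsto_natCast_atTop_atTop
  refine h.congr fun n => ?_
  simp only [Function.comp_apply]
  rw [one_div_mul_eq_div, Nat.floor_div_eq_div]

lemma identDistrib_window (hindep : iIndepFun ξ P)
    (hident : ∀ n, IdentDistrib (ξ n) (ξ 0) P P) (K n : ℕ) :
    IdentDistrib (fun ω (i : Fin K) => ξ (n + i) ω) (fun ω (i : Fin K) => ξ i ω) P P := by
  refine IdentDistrib.pi (X := fun i : Fin K => ξ (n + i)) (Y := fun i : Fin K => ξ i)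
    (fun i => (hident _).trans (hident _).symm) ?_ ?_
  · exact hindep.precomp (g := fun i : Fin K => n + (i : ℕ)) fun a b hab => by
      simpa [Fin.ext_iff] using hab
  · exact hindep.precomp (g := fun i : Fin K => (i : ℕ)) Fin.val_injective

lemma iIndepFun_blocks (hindep : iIndepFun ξ P) (hident : ∀ n, IdentDistrib (ξ n) (ξ 0) P P)
    (B : ℕ) : iIndepFun (fun (b : ℕ) ω (j : Fin B) => ξ (b * B + j) ω) P := by
  refine iIndepFun_curry (X := fun p : ℕ × Fin B => ξ (p.1 * B + p.2))
    (fun p => (hident _).aemeasurable_fst) (hindep.precomp (g := fun p : ℕ × Fin B =>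
      p.1 * B + (p.2 : ℕ)) ?_)
  rintro ⟨b, j⟩ ⟨b', j'⟩ h
  have hB : 0 < B := j.pos
  have hdiv := congrArg (· / B) h
  have hmod := congrArg (· % B) h
  simp only [Nat.mul_comm _ B, Nat.mul_add_div hB, Nat.div_eq_of_lt j.isLt,
    Nat.div_eq_of_lt j'.isLt, Nat.mul_add_mod, Nat.mod_eq_of_lt j.isLt,
    Nat.mod_eq_of_lt j'.isLt, add_zero] at hdiv hmod
  exact Prod.ext hdiv (Fin.ext hmod)

/-- The index set of the first `L` positions in each of the first `q` blocks of length `B`. -/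
def blockIndices (B L q : ℕ) : Finset ℕ :=
  (Finset.range q ×ˢ Finset.range L).image fun p => p.1 * B + p.2

lemma blockIndices_injOn {B L : ℕ} (hLB : L ≤ B) (q : ℕ) :
    Set.InjOn (fun p : ℕ × ℕ => p.1 * B + p.2) (Finset.range q ×ˢ Finset.range L : Finset _) := by
  rintro ⟨b, j⟩ hp ⟨b', j'⟩ hp' h
  simp only [Finset.coe_product, Finset.coe_range, Set.mem_prod, Set.mem_Iio] at hp hp'
  have hj : j < B := hp.2.trans_le hLB
  have hj' : j' < B := hp'.2.trans_le hLB
  have hB : 0 < B := by omega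
  have hdiv := congrArg (· / B) h
  have hmod := congrArg (· % B) h
  simp only [Nat.mul_comm _ B, Nat.mul_add_div hB, Nat.div_eq_of_lt hj,
    Nat.div_eq_of_lt hj', Nat.mul_add_mod, Nat.mod_eq_of_lt hj,
    Nat.mod_eq_of_lt hj', add_zero] at hdiv hmod
  exact Prod.ext hdiv hmod

lemma card_blockIndices {B L : ℕ} (hLB : L ≤ B) (q : ℕ) : (blockIndices B L q).card = q * L := by
  rw [blockIndices, Finset.card_image_of_injOn (blockIndices_injOn hLB q)]
  simp

lemma sum_blockIndices {B L : ℕ} (hLB : L ≤ B) (q : ℕ) (z : ℕ → ℝ) :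
    ∑ n ∈ blockIndices B L q, z n = ∑ b ∈ Finset.range q, ∑ j ∈ Finset.range L, z (b * B + j) := by
  rw [blockIndices, Finset.sum_image (blockIndices_injOn hLB q), Finset.sum_product]

lemma blockIndices_subset {B L : ℕ} (hLB : L ≤ B) (n : ℕ) :
    blockIndices B L (n / B) ⊆ Finset.range n := by
  intro i hi
  simp only [blockIndices, Finset.mem_image, Finset.mem_product, Finset.mem_range,
    Prod.exists] at hi ⊢
  obtain ⟨b, j, ⟨hb, hj⟩, rfl⟩ := hi
  calc b * B + j < b * B + B := by omega
    _ = (b + 1) * B := by ring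
    _ ≤ n / B * B := Nat.mul_le_mul_right _ hb
    _ ≤ n := Nat.div_mul_le_self n B

variable [IsProbabilityMeasure P]

/-- Windows starting in the first `L` positions of a block of length `L + K` do not leave it, so
the partial sums of `h` over the blocks are i.i.d. and the classical central limit theorem
applies to them. -/
lemma tendsto_charFun_block_sum (hindep : iIndepFun ξ P)
    (hident : ∀ n, IdentDistrib (ξ n) (ξ 0) P P) {K : ℕ} {h : (Fin K → E) → ℝ}
    (hh : Measurable h) {Z : ℕ → Ω → ℝ} (hZdef : ∀ n ω, Z n ω = h fun i => ξ (n + i) ω)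
    (hZ : ∀ n, MemLp (Z n) 2 P) (hmean : ∀ n, ∫ ω, Z n ω ∂P = 0) {v : ℝ}
    (hv : ∀ n, ∫ ω, Z n ω ^ 2 ∂P = v) (horth : ∀ n n', n < n' → ∫ ω, Z n ω * Z n' ω ∂P = 0)
    (L : ℕ) {B : ℕ} (hB : B = L + K) (hB0 : 0 < B) (t : ℝ) :
    Tendsto (fun n : ℕ => charFun (P.map fun ω =>
        (√(n : ℝ))⁻¹ * ∑ i ∈ blockIndices B L (n / B), Z i ω) t) atTop
      (𝓝 (Complex.exp (-((L / B * v * t ^ 2 / 2 : ℝ) : ℂ)))) := by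
  have hLB : L ≤ B := by omega
  -- The sum of `h` over the windows inside one block, as a function of the block.
  let G : (Fin B → E) → ℝ := fun y => ∑ j : Fin L, h fun i : Fin K => y ⟨j + i, by omega⟩
  have hG : Measurable G := by
    refine Finset.measurable_fun_sum _ fun j _ => hh.comp ?_
    exact measurable_pi_lambda _ fun i => measurable_pi_apply _
  let A : ℕ → Ω → ℝ := fun b ω => G fun j => ξ (b * B + j) ω
  have hAsum (b : ℕ) (ω : Ω) : A b ω = ∑ j ∈ Finset.range L, Z (b * B + j) ω := by
    simp only [A, G, hZdef, Finset.sum_range, add_assoc]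
  have hAindep : iIndepFun A P :=
    (iIndepFun_blocks hindep hident B).comp (fun _ => G) fun _ => hG
  have hAident (b : ℕ) : IdentDistrib (A b) (A 0) P P := by
    have h1 := (identDistrib_window hindep hident B (b * B)).trans
      (identDistrib_window hindep hident B (0 * B)).symm
    exact h1.comp hG
  have hA0 (ω : Ω) : A 0 ω = ∑ j ∈ Finset.range L, Z j ω := by
    simp [hAsum]
  have hALp : MemLp (A 0) 2 P := by
    have : A 0 = fun ω => ∑ j ∈ Finset.range L, Z j ω := funext hA0
    rw [this]
    exact memLp_finsetSum _ fun n _ => hZ n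
  have hAmean : ∫ ω, A 0 ω ∂P = 0 := by
    simp_rw [hA0]
    rw [integral_finsetSum _ fun n _ => (hZ n).integrable one_le_two]
    simp [hmean]
  have hAvar : Var[A 0; P] = L * v := by
    rw [variance_of_integral_eq_zero hALp.aemeasurable hAmean]
    simp_rw [hA0]
    rw [integral_sq_sum_eq_card_mul hZ hv horth, Finset.card_range]
  have hv0 : 0 ≤ v := by
    rw [← hv 0]
    exact integral_nonneg fun ω => sq_nonneg _
  have hclt := tendstoInDistribution_inv_sqrt_mul_sum_sub (P := P) (X := A)
    (P' := gaussianReal 0 Var[A 0; P].toNNReal) (Y := id) ⟨by fun_prop, by simp⟩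
    hALp hAindep hAident
  have hdiv : Tendsto (fun n : ℕ => n / B) atTop atTop := Nat.tendsto_div_const_atTop hB0.ne'
  have hclt' : TendstoInDistribution (fun (n : ℕ) ω => (√((n / B : ℕ) : ℝ))⁻¹ *
      (∑ k ∈ Finset.range (n / B), A k ω - (n / B : ℕ) * P[A 0])) atTop id (fun _ => P)
      (gaussianReal 0 Var[A 0; P].toNNReal) :=
    ⟨fun n => hclt.forall_aemeasurable (n / B), hclt.aemeasurable_limit, hclt.tendsto.comp hdiv⟩
  have hratio : Tendsto (fun n : ℕ => √(((n / B : ℕ) : ℝ) / n)) atTop (𝓝 √(1 / B)) :=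
    (tendsto_natDiv_div B).sqrt
  have hslutsky := hclt'.continuous_comp_prodMk_of_tendstoInMeasure_const
    (g := fun x : ℝ × ℝ => x.2 * x.1) (by fun_prop)
    (Y := fun (n : ℕ) (_ : Ω) => √(((n / B : ℕ) : ℝ) / n)) (c := √(1 / B))
    (tendstoInMeasure_of_tendsto_ae (fun n => by fun_prop) (ae_of_all _ fun _ => hratio))
    (fun n => by fun_prop)
  have hchar := ProbabilityMeasure.tendsto_iff_tendsto_charFun.1 hslutsky.tendsto t
  refine Tendsto.congr (fun n => ?_) (hchar.trans (le_of_eq ?_))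
  · simp only [ProbabilityMeasure.coe_mk]
    congr 2
    ext ω
    rw [hAmean, mul_zero, sub_zero, sum_blockIndices hLB, Real.sqrt_div (by positivity)]
    simp_rw [← hAsum]
    rcases Nat.eq_zero_or_pos (n / B) with h0 | h0
    · simp [h0]
    · have : √((n / B : ℕ) : ℝ) ≠ 0 := by positivity
      field_simp
  · simp only [ProbabilityMeasure.coe_mk, id]
    rw [charFun_map_mul, charFun_gaussianReal, hAvar, Real.coe_toNNReal _ (by positivity)]
    congr 2
    have hsq : √(1 / (B : ℝ)) ^ 2 = 1 / B := Real.sq_sqrt (by positivity)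
    rw [← Complex.ofReal_pow, mul_pow, hsq]
    push_cast
    ring

/-- Central limit theorem for a centred function `h` of a moving window of an i.i.d. sequence,
when its values `Z n` at different times are orthogonal. The sequence `Z` is cut into blocks of
length `L + K`, separated by gaps of length `K`; by orthogonality the gaps and the incomplete last
block contribute to the mean square of the normalized sum only about `K / (L + K)`. -/
theorem tendsto_charFun_window_sum (hindep : iIndepFun ξ P)
    (hident : ∀ n, IdentDistrib (ξ n) (ξ 0) P P) {K : ℕ} {h : (Fin K → E) → ℝ}
    (hh : Measurable h) {Z : ℕ → Ω → ℝ} (hZdef : ∀ n ω, Z n ω = h fun i => ξ (n + i) ω)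
    (hZ : ∀ n, MemLp (Z n) 2 P) (hmean : ∀ n, ∫ ω, Z n ω ∂P = 0) {v : ℝ}
    (hv : ∀ n, ∫ ω, Z n ω ^ 2 ∂P = v) (horth : ∀ n n', n < n' → ∫ ω, Z n ω * Z n' ω ∂P = 0)
    (t : ℝ) :
    Tendsto (fun n : ℕ => charFun (P.map fun ω => (√(n : ℝ))⁻¹ * ∑ i ∈ Finset.range n, Z i ω) t)
      atTop (𝓝 (Complex.exp (-((v * t ^ 2 / 2 : ℝ) : ℂ)))) := by
  have hv0 : 0 ≤ v := by
    rw [← hv 0]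
    exact integral_nonneg fun ω => sq_nonneg _
  let B : ℕ → ℕ := fun L => L + 1 + K
  have hB0 (L : ℕ) : (0 : ℝ) < B L := by simp only [B]; positivity
  have hBtop : Tendsto (fun L => (B L : ℝ)) atTop atTop := by
    refine tendsto_natCast_atTop_atTop.comp (tendsto_atTop_mono (fun L => ?_) tendsto_id)
    simp only [B, id]
    omega
  have hKB : Tendsto (fun L => (K : ℝ) / B L) atTop (𝓝 0) := hBtop.const_div_atTop _
  refine tendsto_of_approx
    (b := fun L n => charFun (P.map fun ω =>
      (√(n : ℝ))⁻¹ * ∑ i ∈ blockIndices (B L) (L + 1) (n / B L), Z i ω) t)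
    (β := fun L => Complex.exp (-((((L + 1 : ℕ) : ℝ) / B L * v * t ^ 2 / 2 : ℝ) : ℂ)))
    (r := fun L n => |t| * √(((K : ℝ) / B L + B L / n) * v))
    (δ := fun L => |t| * √((K : ℝ) / B L * v))
    (fun L => tendsto_charFun_block_sum hindep hident hh hZdef hZ hmean hv horth (L + 1) rfl
      (Nat.add_pos_left L.succ_pos K) t) ?_ (fun L => ?_) ?_ fun L n => ?_
  · have h1 : Tendsto (fun L : ℕ => ((L + 1 : ℕ) : ℝ) / B L) atTop (𝓝 1) := by
      have : (fun L : ℕ => ((L + 1 : ℕ) : ℝ) / B L) = fun L => 1 - (K : ℝ) / B L := by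
        ext L
        have := (hB0 L).ne'
        rw [eq_sub_iff_add_eq, ← add_div, div_eq_one_iff_eq this]
        change _ = ((L + 1 + K : ℕ) : ℝ)
        push_cast
        ring
      rw [this]
      simpa using hKB.const_sub 1
    have h2 : Tendsto (fun L : ℕ => ((L + 1 : ℕ) : ℝ) / B L * v * t ^ 2 / 2) atTop
        (𝓝 (v * t ^ 2 / 2)) := by
      simpa using ((h1.mul_const v).mul_const (t ^ 2)).div_const 2
    exact (Complex.continuous_exp.tendsto _).comp
      ((Complex.continuous_ofReal.tendsto _).comp h2).neg
  · have h1 : Tendsto (fun n : ℕ => (B L : ℝ) / n) atTop (𝓝 0) :=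
      tendsto_natCast_atTop_atTop.const_div_atTop _
    simpa using (((h1.const_add ((K : ℝ) / B L)).mul_const v).sqrt).const_mul |t|
  · simpa using ((hKB.mul_const v).sqrt).const_mul |t|
  · have hLB : L + 1 ≤ B L := by simp only [B]; omega
    have hint (s : Finset ℕ) : Integrable (fun ω => (√(n : ℝ))⁻¹ * ∑ i ∈ s, Z i ω) P :=
      (integrable_finsetSum _ fun i _ => (hZ i).integrable one_le_two).const_mul _
    refine (norm_charFun_map_sub_le (hint _) (hint _) t).trans ?_
    refine mul_le_mul_of_nonneg_left ?_ (abs_nonneg t)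
    set M := blockIndices (B L) (L + 1) (n / B L) with hM
    have hsub : M ⊆ Finset.range n := blockIndices_subset hLB n
    have hdiff (ω : Ω) : |(√(n : ℝ))⁻¹ * ∑ i ∈ Finset.range n, Z i ω
        - (√(n : ℝ))⁻¹ * ∑ i ∈ M, Z i ω| = (√(n : ℝ))⁻¹ * |∑ i ∈ Finset.range n \ M, Z i ω| := by
      rw [← mul_sub, ← Finset.sum_sdiff hsub, add_sub_cancel_right, abs_mul,
        abs_of_nonneg (by positivity)]
    simp_rw [hdiff]
    rw [integral_const_mul]
    rcases Nat.eq_zero_or_pos n with rfl | hn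
    · simp
    refine (mul_le_mul_of_nonneg_left
      (integral_abs_sum_le hZ hv horth (Finset.range n \ M)) (by positivity)).trans ?_
    rw [← Real.sqrt_inv, ← Real.sqrt_mul (by positivity)]
    refine Real.sqrt_le_sqrt ?_
    rw [← mul_assoc]
    refine mul_le_mul_of_nonneg_right ?_ hv0
    have hn' : (0 : ℝ) < n := by exact_mod_cast hn
    -- The complement of the block indices has at most `(n / B) * K + B` elements.
    have hcard : (Finset.range n \ M).card ≤ n / B L * K + B L := by
      rw [Finset.card_sdiff_of_subset hsub, Finset.card_range, hM, card_blockIndices hLB]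
      have h1 := Nat.div_add_mod n (B L)
      have h2 : n % B L < B L := Nat.mod_lt _ (by simp only [B]; omega)
      have h3 : B L * (n / B L) = n / B L * (L + 1) + n / B L * K := by simp only [B]; ring
      omega
    have hcard' : ((Finset.range n \ M).card : ℝ) ≤ n / B L * K + B L := by
      refine (Nat.cast_le (α := ℝ).2 hcard).trans ?_
      push_cast
      gcongr
      exact Nat.cast_div_le
    calc ((n : ℝ))⁻¹ * ((Finset.range n \ M).card : ℝ) ≤ (n : ℝ)⁻¹ * (n / B L * K + B L) := by
          gcongr
      _ = K / B L + B L / n := by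
          have := (hB0 L).ne'
          field_simp

end Window

/-! ### Lagged products of functions of an i.i.d. sequence -/

section LagProducts

variable {Ω E ι : Type*} [MeasurableSpace Ω] [MeasurableSpace E] {P : Measure Ω}
  {ξ : ℕ → Ω → E} {φ : ι → E → ℝ}

lemma memLp_comp_of_identDistrib (hident : ∀ n, IdentDistrib (ξ n) (ξ 0) P P)
    (hφ : ∀ i, Measurable (φ i)) (hφ2 : ∀ i, MemLp (fun ω => φ i (ξ 0 ω)) 2 P) (i : ι) (n : ℕ) :
    MemLp (fun ω => φ i (ξ n ω)) 2 P :=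
  ((hident n).comp (hφ i)).memLp_iff.2 (hφ2 i)

lemma memLp_lagProd (hindep : iIndepFun ξ P) (hident : ∀ n, IdentDistrib (ξ n) (ξ 0) P P)
    (hφ : ∀ i, Measurable (φ i)) (hφ2 : ∀ i, MemLp (fun ω => φ i (ξ 0 ω)) 2 P) (i j : ι)
    {n n' : ℕ} (hn : n ≠ n') : MemLp (fun ω => φ i (ξ n ω) * φ j (ξ n' ω)) 2 P := by
  have hi := memLp_comp_of_identDistrib hident hφ hφ2 i n
  have hj := memLp_comp_of_identDistrib hident hφ hφ2 j n'
  refine (memLp_two_iff_integrable_sq (hi.1.mul hj.1)).2 ?_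
  refine Integrable.congr ?_ (ae_of_all _ fun ω => (mul_pow _ _ 2).symm)
  exact ((hindep.indepFun hn).comp ((hφ i).pow_const 2) ((hφ j).pow_const 2)).integrable_mul
    hi.integrable_sq hj.integrable_sq

lemma integral_lagProd (hindep : iIndepFun ξ P) (hident : ∀ n, IdentDistrib (ξ n) (ξ 0) P P)
    (hφ : ∀ i, Measurable (φ i)) (hφ0 : ∀ i, ∫ ω, φ i (ξ 0 ω) ∂P = 0) (i j : ι) {n n' : ℕ}
    (hn : n ≠ n') : ∫ ω, φ i (ξ n ω) * φ j (ξ n' ω) ∂P = 0 := by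
  have hm (i : ι) (n : ℕ) : AEStronglyMeasurable (fun ω => φ i (ξ n ω)) P :=
    ((hφ i).comp_aemeasurable (hident n).aemeasurable_fst).aestronglyMeasurable
  have h : ∫ ω, φ i (ξ n ω) ∂P = 0 := by
    rw [← hφ0 i]
    exact ((hident n).comp (hφ i)).integral_eq
  have := ((hindep.indepFun hn).comp (hφ i) (hφ j)).integral_fun_mul_eq_mul_integral (hm i n)
    (hm j n')
  simp only [Function.comp_apply] at this
  rw [this]
  simp only [h, zero_mul]

/-- A product of four centred factors has mean zero as soon as one of the times occurs only
once. -/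
lemma integral_mul_mul_mul_eq_zero (hindep : iIndepFun ξ P)
    (hident : ∀ n, IdentDistrib (ξ n) (ξ 0) P P) (hφ : ∀ i, Measurable (φ i))
    (hφ0 : ∀ i, ∫ ω, φ i (ξ 0 ω) ∂P = 0) (i₁ i₂ i₃ i₄ : ι) {n₁ n₂ n₃ n₄ : ℕ}
    (h₂ : n₁ ≠ n₂) (h₃ : n₁ ≠ n₃) (h₄ : n₁ ≠ n₄) :
    ∫ ω, φ i₁ (ξ n₁ ω) * (φ i₂ (ξ n₂ ω) * φ i₃ (ξ n₃ ω) * φ i₄ (ξ n₄ ω)) ∂P = 0 := by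
  have hξ (n : ℕ) := (hident n).aemeasurable_fst
  have hm (i : ι) (n : ℕ) : AEMeasurable (fun ω => φ i (ξ n ω)) P :=
    (hφ i).comp_aemeasurable (hξ n)
  have h : ∫ ω, φ i₁ (ξ n₁ ω) ∂P = 0 := by
    rw [← hφ0 i₁]
    exact ((hident n₁).comp (hφ i₁)).integral_eq
  let T : Finset ℕ := {n₂, n₃, n₄}
  have hind := hindep.indepFun_finset₀ {n₁} T (by simp [T, h₂, h₃, h₄]) hξ
  let u : (({n₁} : Finset ℕ) → E) → ℝ := fun y => φ i₁ (y ⟨n₁, by simp⟩)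
  let w : (T → E) → ℝ := fun y =>
    φ i₂ (y ⟨n₂, by simp [T]⟩) * φ i₃ (y ⟨n₃, by simp [T]⟩) * φ i₄ (y ⟨n₄, by simp [T]⟩)
  have hu : Measurable u := (hφ i₁).comp (measurable_pi_apply _)
  have hw : Measurable w := (((hφ i₂).comp (measurable_pi_apply _)).mul
    ((hφ i₃).comp (measurable_pi_apply _))).mul ((hφ i₄).comp (measurable_pi_apply _))
  have := (hind.comp hu hw).integral_fun_mul_eq_mul_integral (hm i₁ n₁).aestronglyMeasurable
    (((hm i₂ n₂).mul (hm i₃ n₃)).mul (hm i₄ n₄)).aestronglyMeasurable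
  refine this.trans ?_
  simp only [Function.comp_def, u, h, zero_mul]

lemma integral_lagProd_mul_self (hindep : iIndepFun ξ P)
    (hident : ∀ n, IdentDistrib (ξ n) (ξ 0) P P) (hφ : ∀ i, Measurable (φ i)) (i j i' j' : ι)
    {n n' : ℕ} (hn : n ≠ n') :
    ∫ ω, (φ i (ξ n ω) * φ j (ξ n' ω)) * (φ i' (ξ n ω) * φ j' (ξ n' ω)) ∂P
      = (∫ ω, φ i (ξ 0 ω) * φ i' (ξ 0 ω) ∂P) * ∫ ω, φ j (ξ 0 ω) * φ j' (ξ 0 ω) ∂P := by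
  have hξ (n : ℕ) := (hident n).aemeasurable_fst
  have hm (i j : ι) : Measurable fun y => φ i y * φ j y := (hφ i).mul (hφ j)
  have h (i j : ι) (n : ℕ) :
      ∫ ω, φ i (ξ n ω) * φ j (ξ n ω) ∂P = ∫ ω, φ i (ξ 0 ω) * φ j (ξ 0 ω) ∂P :=
    ((hident n).comp (hm i j)).integral_eq
  have := ((hindep.indepFun hn).comp (hm i i') (hm j j')).integral_fun_mul_eq_mul_integral
    ((hm i i').comp_aemeasurable (hξ n)).aestronglyMeasurable
    ((hm j j').comp_aemeasurable (hξ n')).aestronglyMeasurable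
  simp only [Function.comp_def] at this
  rw [← h i i' n, ← h j j' n', ← this]
  refine integral_congr_ae (ae_of_all _ fun ω => ?_)
  ring

lemma integral_lagProd_mul_of_lag_ne (hindep : iIndepFun ξ P)
    (hident : ∀ n, IdentDistrib (ξ n) (ξ 0) P P) (hφ : ∀ i, Measurable (φ i))
    (hφ0 : ∀ i, ∫ ω, φ i (ξ 0 ω) ∂P = 0) (i j i' j' : ι) (n : ℕ) {k k' : ℕ} (hk : k ≠ k') :
    ∫ ω, (φ i (ξ n ω) * φ j (ξ (n + (k + 1)) ω)) *
      (φ i' (ξ n ω) * φ j' (ξ (n + (k' + 1)) ω)) ∂P = 0 := by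
  rw [← integral_mul_mul_mul_eq_zero hindep hident hφ hφ0 j i i' j' (n₁ := n + (k + 1)) (n₂ := n)
    (n₃ := n) (n₄ := n + (k' + 1)) (by omega) (by omega) (by omega)]
  refine integral_congr_ae (ae_of_all _ fun ω => ?_)
  ring

lemma integral_lagProd_mul_of_lt (hindep : iIndepFun ξ P)
    (hident : ∀ n, IdentDistrib (ξ n) (ξ 0) P P) (hφ : ∀ i, Measurable (φ i))
    (hφ0 : ∀ i, ∫ ω, φ i (ξ 0 ω) ∂P = 0) (i j i' j' : ι) {n n' : ℕ} (hn : n < n') (k k' : ℕ) :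
    ∫ ω, (φ i (ξ n ω) * φ j (ξ (n + (k + 1)) ω)) *
      (φ i' (ξ n' ω) * φ j' (ξ (n' + (k' + 1)) ω)) ∂P = 0 := by
  rw [← integral_mul_mul_mul_eq_zero hindep hident hφ hφ0 i j i' j' (n₁ := n)
    (n₂ := n + (k + 1)) (n₃ := n') (n₄ := n' + (k' + 1)) (by omega) (by omega) (by omega)]
  refine integral_congr_ae (ae_of_all _ fun ω => ?_)
  ring

lemma posSemidef_integral_mul [Fintype ι] {Y : ι → Ω → ℝ} (hY : ∀ i, MemLp (Y i) 2 P) :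
    (Matrix.of fun i j => ∫ ω, Y i ω * Y j ω ∂P).PosSemidef := by
  refine Matrix.PosSemidef.of_dotProduct_mulVec_nonneg ?_ fun x => ?_
  · ext i j
    simp [mul_comm]
  · have hint (i j) : Integrable (fun ω => x i * Y i ω * (x j * Y j ω)) P :=
      ((hY i).const_mul _).integrable_mul ((hY j).const_mul _)
    have : star x ⬝ᵥ (Matrix.of fun i j => ∫ ω, Y i ω * Y j ω ∂P).mulVec x
        = ∫ ω, (∑ i, x i * Y i ω) ^ 2 ∂P := by
      simp_rw [pow_two, Finset.sum_mul_sum]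
      rw [integral_finsetSum _ fun i _ => integrable_finsetSum _ fun j _ => hint i j]
      simp_rw [integral_finsetSum _ fun j _ => hint _ j, dotProduct, Matrix.mulVec, dotProduct,
        Finset.mul_sum]
      refine Finset.sum_congr rfl fun i _ => Finset.sum_congr rfl fun j _ => ?_
      simp only [Pi.star_apply, star_trivial, Matrix.of_apply]
      rw [mul_comm _ (x j), ← mul_assoc, ← integral_const_mul]
      refine integral_congr_ae (ae_of_all _ fun ω => ?_)
      ring
    rw [this]
    exact integral_nonneg fun ω => sq_nonneg _

variable [IsProbabilityMeasure P]

/-- The joint central limit theorem for the lagged products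
`φ i (ξ n) * φ j (ξ (n + k))`, `1 ≤ k ≤ K`. Products with different lags are uncorrelated and
those with the same lag have covariance `S i i' * S j j'`, where `S` is the covariance of `φ`. -/
theorem tendstoInDistribution_lagProd_sum [Fintype ι] [DecidableEq ι] (hindep : iIndepFun ξ P)
    (hident : ∀ n, IdentDistrib (ξ n) (ξ 0) P P)
    (hφ : ∀ i, Measurable (φ i)) (hφ2 : ∀ i, MemLp (fun ω => φ i (ξ 0 ω)) 2 P)
    (hφ0 : ∀ i, ∫ ω, φ i (ξ 0 ω) ∂P = 0) (K : ℕ) {C : Matrix (ι × ι) (ι × ι) ℝ}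
    (hC : C.PosSemidef) (hCeq : ∀ p q, C p q =
      (∫ ω, φ p.1 (ξ 0 ω) * φ q.1 (ξ 0 ω) ∂P) * ∫ ω, φ p.2 (ξ 0 ω) * φ q.2 (ξ 0 ω) ∂P) :
    TendstoInDistribution
      (fun (N : ℕ) (ω : Ω) (k : Fin K) => (WithLp.toLp 2 fun p : ι × ι =>
        (√(N : ℝ))⁻¹ * ∑ n ∈ Finset.range N,
          φ p.1 (ξ n ω) * φ p.2 (ξ (n + ((k : ℕ) + 1)) ω) : EuclideanSpace ℝ (ι × ι)))
      atTop (id : (Fin K → EuclideanSpace ℝ (ι × ι)) → _) (fun _ => P)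
      (Measure.pi fun _ : Fin K => multivariateGaussian 0 C) := by
  have hξ (n : ℕ) := (hident n).aemeasurable_fst
  have hm (i : ι) (n : ℕ) : AEMeasurable (fun ω => φ i (ξ n ω)) P :=
    (hφ i).comp_aemeasurable (hξ n)
  let T : ℕ → Ω → PiLp 2 fun _ : Fin K => EuclideanSpace ℝ (ι × ι) :=
    fun N ω => WithLp.toLp 2 fun k => WithLp.toLp 2 fun p => (√(N : ℝ))⁻¹ *
      ∑ n ∈ Finset.range N, φ p.1 (ξ n ω) * φ p.2 (ξ (n + ((k : ℕ) + 1)) ω)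
  have hT (N : ℕ) : AEMeasurable (T N) P := by
    refine (WithLp.measurable_toLp 2 _).comp_aemeasurable (aemeasurable_pi_lambda _ fun k =>
      (WithLp.measurable_toLp 2 _).comp_aemeasurable (aemeasurable_pi_lambda _ fun p => ?_))
    exact (Finset.aemeasurable_fun_sum _ fun n _ => (hm _ _).mul (hm _ _)).const_mul _
  suffices hmain : TendstoInDistribution T atTop
      (WithLp.toLp 2 : (Fin K → EuclideanSpace ℝ (ι × ι)) →
        PiLp 2 fun _ : Fin K => EuclideanSpace ℝ (ι × ι))
      (fun _ => P)
      (Measure.pi fun _ : Fin K => multivariateGaussian 0 C) from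
    hmain.continuous_comp (g := (WithLp.ofLp :
      (PiLp 2 fun _ : Fin K => EuclideanSpace ℝ (ι × ι)) → _))
      (PiLp.continuous_ofLp 2 _)
  refine ⟨hT, (WithLp.measurable_toLp 2 _).aemeasurable, ?_⟩
  refine ProbabilityMeasure.tendsto_iff_tendsto_charFun.2 fun t => ?_
  simp only [ProbabilityMeasure.coe_mk]
  -- The pairing of the vector of products at time `n` with `t`.
  let W : ℕ → Fin K × (ι × ι) → Ω → ℝ := fun n a ω =>
    φ a.2.1 (ξ n ω) * φ a.2.2 (ξ (n + ((a.1 : ℕ) + 1)) ω)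
  let Z : ℕ → Ω → ℝ := fun n ω => ∑ a : Fin K × (ι × ι), t a.1 a.2 * W n a ω
  let h : (Fin (K + 1) → E) → ℝ := fun y =>
    ∑ a : Fin K × (ι × ι), t a.1 a.2 * (φ a.2.1 (y 0) * φ a.2.2 (y a.1.succ))
  have hh : Measurable h := by
    refine Finset.measurable_fun_sum _ fun a _ => Measurable.const_mul ?_ _
    exact ((hφ _).comp (measurable_pi_apply _)).mul ((hφ _).comp (measurable_pi_apply _))
  have hW (n : ℕ) (a) : MemLp (W n a) 2 P :=
    memLp_lagProd hindep hident hφ hφ2 _ _ (by omega)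
  have hZ (n : ℕ) : MemLp (Z n) 2 P := memLp_finsetSum _ fun a _ => (hW n a).const_mul _
  have hZmul (n n' : ℕ) : ∫ ω, Z n ω * Z n' ω ∂P =
      ∑ a : Fin K × (ι × ι), ∑ b : Fin K × (ι × ι),
        t a.1 a.2 * t b.1 b.2 * ∫ ω, W n a ω * W n' b ω ∂P := by
    have hint (a b) : Integrable (fun ω => t a.1 a.2 * W n a ω * (t b.1 b.2 * W n' b ω)) P :=
      ((hW n a).const_mul _).integrable_mul ((hW n' b).const_mul _)
    simp only [Z, Finset.sum_mul_sum]
    rw [integral_finsetSum _ fun a _ => integrable_finsetSum _ fun b _ => hint a b]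
    refine Finset.sum_congr rfl fun a _ => ?_
    rw [integral_finsetSum _ fun b _ => hint a b]
    refine Finset.sum_congr rfl fun b _ => ?_
    rw [← integral_const_mul]
    refine integral_congr_ae (ae_of_all _ fun ω => ?_)
    ring
  have hmean (n : ℕ) : ∫ ω, Z n ω ∂P = 0 := by
    simp only [Z]
    rw [integral_finsetSum _ fun a _ => ((hW n a).const_mul _).integrable one_le_two]
    refine Finset.sum_eq_zero fun a _ => ?_
    rw [integral_const_mul, integral_lagProd hindep hident hφ hφ0 _ _ (by omega), mul_zero]
  have horth (n n' : ℕ) (hn : n < n') : ∫ ω, Z n ω * Z n' ω ∂P = 0 := by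
    rw [hZmul]
    refine Finset.sum_eq_zero fun a _ => Finset.sum_eq_zero fun b _ => ?_
    rw [integral_lagProd_mul_of_lt hindep hident hφ hφ0 _ _ _ _ hn, mul_zero]
  have hWW (n : ℕ) (a b) : ∫ ω, W n a ω * W n b ω ∂P = if a.1 = b.1 then C a.2 b.2 else 0 := by
    split_ifs with hab
    · simp only [W, hab]
      rw [integral_lagProd_mul_self hindep hident hφ _ _ _ _ (by omega), hCeq]
    · exact integral_lagProd_mul_of_lag_ne hindep hident hφ hφ0 _ _ _ _ n
        (fun h => hab (Fin.ext h))
  have hv (n : ℕ) : ∫ ω, Z n ω ^ 2 ∂P = ∑ k, (t k).ofLp ⬝ᵥ C.mulVec (t k).ofLp := by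
    simp_rw [pow_two]
    rw [hZmul]
    simp_rw [hWW, Fintype.sum_prod_type, dotProduct, Matrix.mulVec, dotProduct, Finset.mul_sum]
    refine Finset.sum_congr rfl fun k _ => ?_
    simp [Fintype.sum_prod_type, Finset.sum_ite_irrel, mul_left_comm, mul_comm]
  have hlim := tendsto_charFun_window_sum hindep hident hh (Z := Z) (fun n ω => rfl) hZ hmean hv
    horth 1
  refine Tendsto.congr (fun N => ?_) (hlim.trans (le_of_eq ?_))
  · have hinner (ω : Ω) :
        inner ℝ (T N ω) t = (√(N : ℝ))⁻¹ * ∑ n ∈ Finset.range N, Z n ω := by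
      simp only [T, Z, W, PiLp.inner_apply, RCLike.inner_apply, conj_trivial,
        ← Fintype.sum_prod_type']
      rw [Finset.sum_comm, Finset.mul_sum]
      refine Finset.sum_congr rfl fun a _ => ?_
      rw [← Finset.mul_sum]
      ring
    have hZm : AEMeasurable (fun ω => (√(N : ℝ))⁻¹ * ∑ n ∈ Finset.range N, Z n ω) P :=
      (Finset.aemeasurable_fun_sum _ fun n _ => (hZ n).aemeasurable).const_mul _
    rw [charFun_apply_real, integral_map hZm (by fun_prop), charFun_apply,
      integral_map (hT N) (by fun_prop)]
    simp only [hinner, Complex.ofReal_one, one_mul]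
  · rw [charFun_pi]
    simp_rw [charFun_multivariateGaussian hC, ← Complex.exp_sum]
    simp [Finset.sum_div]

end LagProducts

/-! ### Empirical correlations -/

section Empirical

/-- Empirical cross-correlations are invariant under standardization. A degenerate `f`, `s = 0`,
has empirical cross-correlation `0`, and so has `φ` if it vanishes along the sequence. -/
lemma empCrossCorr_eq_of_affine {x : ℕ → ℝ} {f g φ ψ : ℝ → ℝ} {a b s s' : ℝ} (hs : 0 ≤ s)
    (hs' : 0 ≤ s') (hf : ∀ n, f (x n) = a + s * φ (x n)) (hg : ∀ n, g (x n) = b + s' * ψ (x n))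
    (hφ : s = 0 → ∀ n, φ (x n) = 0) (hψ : s' = 0 → ∀ n, ψ (x n) = 0) (N k : ℕ) :
    empCrossCorr x N k f g = empCrossCorr x N k φ ψ := by
  rcases Nat.eq_zero_or_pos N with rfl | hN
  · simp [empCrossCorr, empCrossCov]
  have hN' : (N : ℝ) ≠ 0 := by positivity
  have hmean {f φ : ℝ → ℝ} {a s : ℝ} (hf : ∀ n, f (x n) = a + s * φ (x n)) :
      empMean x N f = a + s * empMean x N φ := by
    simp only [empMean, hf, Finset.sum_add_distrib, ← Finset.mul_sum, Finset.sum_const,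
      Finset.card_range, nsmul_eq_mul]
    field_simp
  have hdev {f φ : ℝ → ℝ} {a s : ℝ} (hf : ∀ n, f (x n) = a + s * φ (x n)) (n : ℕ) :
      f (x n) - empMean x N f = s * (φ (x n) - empMean x N φ) := by
    rw [hmean hf, hf]
    ring
  have hstd {f φ : ℝ → ℝ} {a s : ℝ} (hs : 0 ≤ s) (hf : ∀ n, f (x n) = a + s * φ (x n)) :
      empStdDev x N f = s * empStdDev x N φ := by
    simp only [empStdDev, empVar, hdev hf, mul_pow, ← Finset.mul_sum]
    rw [mul_left_comm, Real.sqrt_mul (sq_nonneg s), Real.sqrt_sq hs]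
  have hcov : empCrossCov x N k f g = s * s' * empCrossCov x N k φ ψ := by
    simp only [empCrossCov, hdev hf, hdev hg, Finset.mul_sum]
    refine Finset.sum_congr rfl fun n _ => ?_
    ring
  rw [empCrossCorr, empCrossCorr, hstd hs hf, hstd hs' hg, hcov]
  by_cases h : s = 0
  · simp [h, empCrossCov, empMean, hφ h]
  by_cases h' : s' = 0
  · simp [h', empCrossCov, empMean, hψ h']
  rw [show s * empStdDev x N φ * (s' * empStdDev x N ψ)
    = s * s' * (empStdDev x N φ * empStdDev x N ψ) by ring, mul_div_mul_left _ _ (by positivity)]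

lemma measurable_empMean {f : ℝ → ℝ} (hf : Measurable f) (N : ℕ) :
    Measurable fun x : ℕ → ℝ => empMean x N f :=
  (Finset.measurable_fun_sum _ fun n _ => hf.comp (measurable_pi_apply n)).const_mul _

lemma measurable_empStdDev {f : ℝ → ℝ} (hf : Measurable f) (N : ℕ) :
    Measurable fun x : ℕ → ℝ => empStdDev x N f :=
  ((Finset.measurable_fun_sum _ fun n _ => ((hf.comp (measurable_pi_apply n)).sub
    (measurable_empMean hf N)).pow_const 2).const_mul _).sqrt

lemma measurable_empCrossCov {f g : ℝ → ℝ} (hf : Measurable f) (hg : Measurable g) (N k : ℕ) :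
    Measurable fun x : ℕ → ℝ => empCrossCov x N k f g :=
  (Finset.measurable_fun_sum _ fun n _ =>
    ((hf.comp (measurable_pi_apply n)).sub (measurable_empMean hf N)).mul
      ((hg.comp (measurable_pi_apply (n + k))).sub (measurable_empMean hg N))).const_mul _

/-- The terms on the right are negligible: the first two are a small multiple of a sum of lagged
products and a sum of only `k` of them, the last contains products of two sums of order `√N`,
divided by `N`. -/
lemma sqrt_mul_empCrossCov_sub (x : ℕ → ℝ) (φ ψ : ℝ → ℝ) {N k : ℕ} (hk : k < N) :
    √(N : ℝ) * empCrossCov x N k φ ψ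
        - (√(N : ℝ))⁻¹ * ∑ n ∈ Finset.range N, φ (x n) * ψ (x (n + k))
      = k / (N - k) * ((√(N : ℝ))⁻¹ * ∑ n ∈ Finset.range (N - k), φ (x n) * ψ (x (n + k)))
        - (√(N : ℝ))⁻¹ * ∑ n ∈ Finset.range N \ Finset.range (N - k), φ (x n) * ψ (x (n + k))
        + √(N : ℝ) / (N - k) * ((N - k) * (empMean x N φ * empMean x N ψ)
          - empMean x N φ * ∑ n ∈ Finset.range (N - k), ψ (x (n + k))
          - empMean x N ψ * ∑ n ∈ Finset.range (N - k), φ (x n)) := by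
  have hNk : (0 : ℝ) < N - k := sub_pos.2 (Nat.cast_lt.2 hk)
  have hN : (0 : ℝ) < N := by exact_mod_cast (Nat.zero_le k).trans_lt hk
  have hsub : Finset.range (N - k) ⊆ Finset.range N := Finset.range_mono (Nat.sub_le N k)
  rw [← Finset.sum_sdiff hsub]
  set A := ∑ n ∈ Finset.range (N - k), φ (x n) * ψ (x (n + k)) with hA
  set u := empMean x N φ
  set w := empMean x N ψ
  have hcov : empCrossCov x N k φ ψ = 1 / (N - k) * (A
      - u * ∑ n ∈ Finset.range (N - k), ψ (x (n + k)) - w * ∑ n ∈ Finset.range (N - k), φ (x n)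
      + (N - k) * (u * w)) := by
    rw [empCrossCov]
    congr 1
    simp only [sub_mul, mul_sub, Finset.sum_sub_distrib, ← Finset.mul_sum, ← Finset.sum_mul,
      Finset.sum_const, Finset.card_range, nsmul_eq_mul, Nat.cast_sub hk.le]
    ring
  rw [hcov]
  have hsq : √(N : ℝ) ^ 2 = N := Real.sq_sqrt hN.le
  have hs0 : √(N : ℝ) ≠ 0 := by positivity
  have hne := hNk.ne'
  field_simp
  rw [hsq]
  ring

variable {Ω : Type*} [MeasurableSpace Ω] {P : Measure Ω} [IsProbabilityMeasure P] {ξ : ℕ → Ω → ℝ}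

/-- For centred `φ i`, `φ j`, subtracting the empirical means changes the normalized empirical
cross-covariance by a quantity that is `O(N ^ (-1 / 2))` in `L¹`. -/
lemma integral_abs_sqrt_mul_empCrossCov_sub_le {ι : Type*} {φ : ι → ℝ → ℝ}
    (hindep : iIndepFun ξ P) (hident : ∀ n, IdentDistrib (ξ n) (ξ 0) P P)
    (hφ : ∀ i, Measurable (φ i)) (hφ2 : ∀ i, MemLp (fun ω => φ i (ξ 0 ω)) 2 P)
    (hφ0 : ∀ i, ∫ ω, φ i (ξ 0 ω) ∂P = 0) (i j : ι) {N k : ℕ} (hk0 : 0 < k) (hk : k < N)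
    {c d : ℝ} (hc : ∫ ω, φ i (ξ 0 ω) ^ 2 ∂P = c) (hd : ∫ ω, φ j (ξ 0 ω) ^ 2 ∂P = d) :
    Integrable (fun ω => √(N : ℝ) * empCrossCov (fun n => ξ n ω) N k (φ i) (φ j)
        - (√(N : ℝ))⁻¹ * ∑ n ∈ Finset.range N, φ i (ξ n ω) * φ j (ξ (n + k) ω)) P ∧
    ∫ ω, |√(N : ℝ) * empCrossCov (fun n => ξ n ω) N k (φ i) (φ j)
        - (√(N : ℝ))⁻¹ * ∑ n ∈ Finset.range N, φ i (ξ n ω) * φ j (ξ (n + k) ω)| ∂P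
      ≤ k / (N - k) * √(c * d) + (√(N : ℝ))⁻¹ * √(k * (c * d))
        + √(N : ℝ) / (N - k) * (3 / 2 * (c + d)) := by
  have hNk : (0 : ℝ) < N - k := sub_pos.2 (Nat.cast_lt.2 hk)
  have hN : (0 : ℝ) < N := by exact_mod_cast hk0.trans hk
  have hL2 := memLp_comp_of_identDistrib hident hφ hφ2
  have hsq (i : ι) (n : ℕ) : ∫ ω, φ i (ξ n ω) ^ 2 ∂P = ∫ ω, φ i (ξ 0 ω) ^ 2 ∂P :=
    ((hident n).comp ((hφ i).pow_const 2)).integral_eq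
  have horth (i : ι) (l n n' : ℕ) (hn : n < n') :
      ∫ ω, φ i (ξ (n + l) ω) * φ i (ξ (n' + l) ω) ∂P = 0 :=
    integral_lagProd hindep hident hφ hφ0 i i (by omega)
  -- Mean squares of the sums of `φ i` and `φ j`, started at time `l`.
  have hsum (i : ι) (l M : ℕ) : ∫ ω, (∑ n ∈ Finset.range M, φ i (ξ (n + l) ω)) ^ 2 ∂P
      = M * ∫ ω, φ i (ξ 0 ω) ^ 2 ∂P := by
    rw [integral_sq_sum_eq_card_mul (fun n => hL2 i (n + l)) (fun n => hsq i (n + l))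
      (horth i l), Finset.card_range]
  have hsumint (i : ι) (l M : ℕ) :
      Integrable (fun ω => (∑ n ∈ Finset.range M, φ i (ξ (n + l) ω)) ^ 2) P :=
    (memLp_finsetSum _ fun n _ => hL2 i (n + l)).integrable_sq
  have hprodL2 (n : ℕ) : MemLp (fun ω => φ i (ξ n ω) * φ j (ξ (n + k) ω)) 2 P :=
    memLp_lagProd hindep hident hφ hφ2 i j (by omega)
  have hprodsq (n : ℕ) : ∫ ω, (φ i (ξ n ω) * φ j (ξ (n + k) ω)) ^ 2 ∂P = c * d := by
    simp_rw [pow_two]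
    rw [integral_lagProd_mul_self hindep hident hφ i j i j (by omega), ← hc, ← hd]
    simp_rw [pow_two]
  have hprod (s : Finset ℕ) : ∫ ω, |∑ n ∈ s, φ i (ξ n ω) * φ j (ξ (n + k) ω)| ∂P
      ≤ √(s.card * (c * d)) := by
    obtain ⟨l, rfl⟩ : ∃ l, k = l + 1 := ⟨k - 1, by omega⟩
    exact integral_abs_sum_le hprodL2 hprodsq (fun n n' hn =>
      integral_lagProd_mul_of_lt hindep hident hφ hφ0 i j i j hn l l) s
  have hprodint (s : Finset ℕ) :
      Integrable (fun ω => ∑ n ∈ s, φ i (ξ n ω) * φ j (ξ (n + k) ω)) P :=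
    integrable_finsetSum _ fun n _ => (hprodL2 n).integrable one_le_two
  let A₁ : Ω → ℝ := fun ω => ∑ n ∈ Finset.range (N - k), φ i (ξ n ω) * φ j (ξ (n + k) ω)
  let A₂ : Ω → ℝ := fun ω =>
    ∑ n ∈ Finset.range N \ Finset.range (N - k), φ i (ξ n ω) * φ j (ξ (n + k) ω)
  let S : ι → ℕ → ℕ → Ω → ℝ := fun i l M ω => ∑ n ∈ Finset.range M, φ i (ξ (n + l) ω)
  let D : Ω → ℝ := fun ω =>
    k / (N - k) * ((√(N : ℝ))⁻¹ * |A₁ ω|) + (√(N : ℝ))⁻¹ * |A₂ ω| +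
      √(N : ℝ) / (N - k) * (1 / (2 * N) * ((S i 0 N ω ^ 2 + S j 0 N ω ^ 2) +
        (S i 0 N ω ^ 2 + S j k (N - k) ω ^ 2) + (S j 0 N ω ^ 2 + S i 0 (N - k) ω ^ 2)))
  have hDint : Integrable D P := by
    refine ((((hprodint _).abs.const_mul _).const_mul _).add ((hprodint _).abs.const_mul _)).add
      (((((hsumint i 0 N).add (hsumint j 0 N)).add ((hsumint i 0 N).add
        (hsumint j k (N - k)))).add ((hsumint j 0 N).add
          (hsumint i 0 (N - k)))).const_mul _ |>.const_mul _)
  have hbound (ω : Ω) : |√(N : ℝ) * empCrossCov (fun n => ξ n ω) N k (φ i) (φ j)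
      - (√(N : ℝ))⁻¹ * ∑ n ∈ Finset.range N, φ i (ξ n ω) * φ j (ξ (n + k) ω)| ≤ D ω := by
    rw [sqrt_mul_empCrossCov_sub (fun n => ξ n ω) (φ i) (φ j) hk]
    have hmean (i : ι) : empMean (fun n => ξ n ω) N (φ i) = S i 0 N ω / N := by
      simp [empMean, S, div_eq_inv_mul]
    have hamgm (a b : ℝ) : |a / N * b| ≤ 1 / (2 * N) * (a ^ 2 + b ^ 2) := by
      rw [div_mul_eq_mul_div, abs_div, abs_of_pos hN, abs_mul, div_le_iff₀ hN]
      have : 1 / (2 * (N : ℝ)) * (a ^ 2 + b ^ 2) * N = (a ^ 2 + b ^ 2) / 2 := by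
        field_simp
      rw [this, ← sq_abs a, ← sq_abs b]
      nlinarith [sq_nonneg (|a| - |b|)]
    have h1 : |(N - k) * (S i 0 N ω / N * (S j 0 N ω / N))|
        ≤ 1 / (2 * N) * (S i 0 N ω ^ 2 + S j 0 N ω ^ 2) := by
      refine le_trans ?_ (hamgm (S i 0 N ω) (S j 0 N ω))
      rw [show (N - k) * (S i 0 N ω / N * (S j 0 N ω / N))
        = ((N - k) / N) * (S i 0 N ω / N * S j 0 N ω) by ring, abs_mul]
      refine mul_le_of_le_one_left (abs_nonneg _) ?_
      rw [abs_of_nonneg (by positivity), div_le_one hN]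
      simp
    have h2 := hamgm (S i 0 N ω) (S j k (N - k) ω)
    have h3 := hamgm (S j 0 N ω) (S i 0 (N - k) ω)
    rw [hmean i, hmean j]
    change |k / (N - k) * ((√(N : ℝ))⁻¹ * A₁ ω) - (√(N : ℝ))⁻¹ * A₂ ω +
      √(N : ℝ) / (N - k) * ((N - k) * (S i 0 N ω / N * (S j 0 N ω / N))
        - S i 0 N ω / N * S j k (N - k) ω - S j 0 N ω / N * S i 0 (N - k) ω)| ≤ D ω
    refine (abs_add_le _ _).trans (add_le_add ((abs_sub _ _).trans (add_le_add ?_ ?_)) ?_)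
    · rw [abs_mul, abs_mul, abs_of_nonneg (by positivity), abs_of_nonneg (by positivity)]
    · rw [abs_mul, abs_of_nonneg (by positivity)]
    · rw [abs_mul, abs_of_nonneg (by positivity)]
      refine mul_le_mul_of_nonneg_left ?_ (by positivity)
      refine ((abs_sub _ _).trans (add_le_add ((abs_sub _ _).trans (add_le_add h1 h2)) h3)).trans
        (le_of_eq ?_)
      ring
  have hm (i : ι) (n : ℕ) : AEMeasurable (fun ω => φ i (ξ n ω)) P := (hL2 i n).aemeasurable
  have hR : Integrable (fun ω => √(N : ℝ) * empCrossCov (fun n => ξ n ω) N k (φ i) (φ j)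
      - (√(N : ℝ))⁻¹ * ∑ n ∈ Finset.range N, φ i (ξ n ω) * φ j (ξ (n + k) ω)) P := by
    refine hDint.mono' ?_ (ae_of_all _ hbound)
    have hemp := (measurable_empCrossCov (hφ i) (hφ j) N k).comp_aemeasurable
      (aemeasurable_pi_lambda _ fun n => (hident n).aemeasurable_fst)
    exact ((hemp.const_mul _).sub ((hprodint _).aemeasurable.const_mul _)).aestronglyMeasurable
  refine ⟨hR, (integral_mono hR.abs hDint hbound).trans ?_⟩
  have hDval : ∫ ω, D ω ∂P = k / (N - k) * ((√(N : ℝ))⁻¹ * ∫ ω, |A₁ ω| ∂P)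
      + (√(N : ℝ))⁻¹ * ∫ ω, |A₂ ω| ∂P + √(N : ℝ) / (N - k) * (1 / (2 * N) *
        ((N * c + N * d) + (N * c + (N - k : ℕ) * d) + (N * d + (N - k : ℕ) * c))) := by
    have e₁ := ((hprodint (Finset.range (N - k))).abs.const_mul (√(N : ℝ))⁻¹).const_mul
      ((k : ℝ) / (N - k))
    have e₂ := (hprodint (Finset.range N \ Finset.range (N - k))).abs.const_mul (√(N : ℝ))⁻¹
    have e₃ := (hsumint i 0 N).add (hsumint j 0 N)
    have e₄ := (hsumint i 0 N).add (hsumint j k (N - k))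
    have e₅ := (hsumint j 0 N).add (hsumint i 0 (N - k))
    have e₆ := (((e₃.add e₄).add e₅).const_mul (1 / (2 * (N : ℝ)))).const_mul
      (√(N : ℝ) / (N - k))
    refine (integral_add (e₁.add e₂) e₆).trans ?_
    refine congrArg₂ (· + ·) ((integral_add e₁ e₂).trans ?_) ?_
    · rw [integral_const_mul, integral_const_mul, integral_const_mul]
    · rw [integral_const_mul, integral_const_mul]
      refine congrArg _ (congrArg _ ((integral_add (e₃.add e₄) e₅).trans ?_))
      refine congrArg₂ (· + ·) ((integral_add e₃ e₄).trans (congrArg₂ (· + ·) ?_ ?_)) ?_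
      · refine (integral_add (hsumint i 0 N) (hsumint j 0 N)).trans ?_
        rw [hsum, hsum, hc, hd]
      · refine (integral_add (hsumint i 0 N) (hsumint j k (N - k))).trans ?_
        rw [hsum, hsum, hc, hd]
      · refine (integral_add (hsumint j 0 N) (hsumint i 0 (N - k))).trans ?_
        rw [hsum, hsum, hc, hd]
  have hc0 : 0 ≤ c := hc ▸ integral_nonneg fun ω => sq_nonneg _
  have hd0 : 0 ≤ d := hd ▸ integral_nonneg fun ω => sq_nonneg _
  have hNkle : ((N - k : ℕ) : ℝ) ≤ N := Nat.cast_le.2 (Nat.sub_le N k)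
  have hs0 : 0 < √(N : ℝ) := Real.sqrt_pos.2 hN
  rw [hDval]
  refine add_le_add (add_le_add (mul_le_mul_of_nonneg_left ?_ (by positivity))
    (mul_le_mul_of_nonneg_left ?_ (by positivity)))
    (mul_le_mul_of_nonneg_left ?_ (by positivity))
  · refine (mul_le_mul_of_nonneg_left (hprod _) (by positivity)).trans ?_
    rw [Finset.card_range, inv_mul_le_iff₀ hs0, ← Real.sqrt_mul hN.le]
    exact Real.sqrt_le_sqrt (mul_le_mul_of_nonneg_right hNkle (by positivity))
  · refine (hprod _).trans (Real.sqrt_le_sqrt (le_of_eq ?_))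
    rw [Finset.card_sdiff_of_subset (Finset.range_mono (Nat.sub_le N k)), Finset.card_range,
      Finset.card_range, Nat.sub_sub_self hk.le]
  · calc 1 / (2 * (N : ℝ)) *
          ((N * c + N * d) + (N * c + (N - k : ℕ) * d) + (N * d + (N - k : ℕ) * c))
        ≤ 1 / (2 * (N : ℝ)) * ((N * c + N * d) + (N * c + N * d) + (N * d + N * c)) := by
          gcongr
      _ = 3 / 2 * (c + d) := by
          field_simp
          ring

lemma tendsto_integral_abs_sqrt_mul_empCrossCov_sub {ι : Type*} {φ : ι → ℝ → ℝ}
    (hindep : iIndepFun ξ P) (hident : ∀ n, IdentDistrib (ξ n) (ξ 0) P P)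
    (hφ : ∀ i, Measurable (φ i)) (hφ2 : ∀ i, MemLp (fun ω => φ i (ξ 0 ω)) 2 P)
    (hφ0 : ∀ i, ∫ ω, φ i (ξ 0 ω) ∂P = 0) (i j : ι) {k : ℕ} (hk0 : 0 < k) :
    Tendsto (fun N : ℕ => ∫ ω, |√(N : ℝ) * empCrossCov (fun n => ξ n ω) N k (φ i) (φ j)
        - (√(N : ℝ))⁻¹ * ∑ n ∈ Finset.range N, φ i (ξ n ω) * φ j (ξ (n + k) ω)| ∂P)
      atTop (𝓝 0) := by
  set c := ∫ ω, φ i (ξ 0 ω) ^ 2 ∂P with hc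
  set d := ∫ ω, φ j (ξ 0 ω) ^ 2 ∂P with hd
  have hNk : Tendsto (fun N : ℕ => (N : ℝ) - k) atTop atTop :=
    tendsto_atTop_add_const_right _ _ tendsto_natCast_atTop_atTop
  have hsqrt : Tendsto (fun N : ℕ => (√(N : ℝ))⁻¹) atTop (𝓝 0) :=
    tendsto_inv_atTop_zero.comp (Real.tendsto_sqrt_atTop.comp tendsto_natCast_atTop_atTop)
  have h₁ : Tendsto (fun N : ℕ => (k : ℝ) / (N - k)) atTop (𝓝 0) := hNk.const_div_atTop _
  have h₂ : Tendsto (fun N : ℕ => √(N : ℝ) / (N - k)) atTop (𝓝 0) := by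
    have : Tendsto (fun N : ℕ => (√(N : ℝ))⁻¹ * (1 + (k : ℝ) / (N - k))) atTop (𝓝 0) := by
      simpa using hsqrt.mul (h₁.const_add 1)
    refine this.congr' ?_
    filter_upwards [eventually_gt_atTop k] with N hN
    have hne : (N : ℝ) - k ≠ 0 := (sub_pos.2 (Nat.cast_lt.2 hN)).ne'
    have hN0 : (0 : ℝ) < N := by exact_mod_cast hk0.trans hN
    have hs0 : √(N : ℝ) ≠ 0 := (Real.sqrt_pos.2 hN0).ne'
    have hsq : √(N : ℝ) ^ 2 = N := Real.sq_sqrt hN0.le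
    field_simp
    rw [hsq]
    ring
  have hlim : Tendsto (fun N : ℕ => k / (N - k) * √(c * d) + (√(N : ℝ))⁻¹ * √(k * (c * d))
      + √(N : ℝ) / (N - k) * (3 / 2 * (c + d))) atTop (𝓝 0) := by
    simpa using ((h₁.mul_const _).add (hsqrt.mul_const _)).add (h₂.mul_const (3 / 2 * (c + d)))
  refine squeeze_zero' (Eventually.of_forall fun N => integral_nonneg fun ω => abs_nonneg _) ?_ hlim
  filter_upwards [eventually_gt_atTop k] with N hN
  exact (integral_abs_sqrt_mul_empCrossCov_sub_le hindep hident hφ hφ2 hφ0 i j hk0 hN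
    hc.symm hd.symm).2

/-- Strong consistency of the empirical variance. -/
lemma ae_tendsto_empVar (hindep : iIndepFun ξ P)
    (hident : ∀ n, IdentDistrib (ξ n) (ξ 0) P P) {φ : ℝ → ℝ} (hφ : Measurable φ)
    (hφ2 : MemLp (fun ω => φ (ξ 0 ω)) 2 P) :
    ∀ᵐ ω ∂P, Tendsto (fun N => empVar (fun n => ξ n ω) N φ) atTop
      (𝓝 (∫ ω, φ (ξ 0 ω) ^ 2 ∂P - (∫ ω, φ (ξ 0 ω) ∂P) ^ 2)) := by
  have h₁ := strong_law_ae_real (fun n ω => φ (ξ n ω)) (hφ2.integrable one_le_two)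
    (fun n n' hn => (hindep.indepFun hn).comp hφ hφ) (fun n => (hident n).comp hφ)
  have hφsq : Measurable fun y => φ y ^ 2 := hφ.pow_const 2
  have h₂ := strong_law_ae_real (fun n ω => φ (ξ n ω) ^ 2) hφ2.integrable_sq
    (fun n n' hn => (hindep.indepFun hn).comp hφsq hφsq) (fun n => (hident n).comp hφsq)
  filter_upwards [h₁, h₂] with ω hω₁ hω₂
  refine (hω₂.sub (hω₁.pow 2)).congr' ?_
  filter_upwards [eventually_gt_atTop 0] with N hN
  have hN' : (N : ℝ) ≠ 0 := by positivity
  simp only [empVar, empMean, sub_sq, Finset.sum_add_distrib, Finset.sum_sub_distrib,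
    Finset.sum_const, Finset.card_range, nsmul_eq_mul, ← Finset.sum_mul, ← Finset.mul_sum]
  field_simp
  ring

end Empirical

/-! ### Standardized functions and the limit theorem -/

section Standardized

variable {Ω : Type*} [MeasurableSpace Ω] {P : Measure Ω} [IsProbabilityMeasure P] {ξ : ℕ → Ω → ℝ}

/-- The limit theorem for empirical cross-covariances of centred functions: by
`tendsto_integral_abs_sqrt_mul_empCrossCov_sub` they may be replaced by sums of lagged products. -/
lemma tendstoInDistribution_empCrossCov {ι : Type*} [Fintype ι] [DecidableEq ι] {φ : ι → ℝ → ℝ}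
    (hindep : iIndepFun ξ P) (hident : ∀ n, IdentDistrib (ξ n) (ξ 0) P P)
    (hφ : ∀ i, Measurable (φ i)) (hφ2 : ∀ i, MemLp (fun ω => φ i (ξ 0 ω)) 2 P)
    (hφ0 : ∀ i, ∫ ω, φ i (ξ 0 ω) ∂P = 0) (K : ℕ) {C : Matrix (ι × ι) (ι × ι) ℝ}
    (hC : C.PosSemidef) (hCeq : ∀ p q, C p q =
      (∫ ω, φ p.1 (ξ 0 ω) * φ q.1 (ξ 0 ω) ∂P) * ∫ ω, φ p.2 (ξ 0 ω) * φ q.2 (ξ 0 ω) ∂P) :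
    TendstoInDistribution
      (fun (N : ℕ) (ω : Ω) (k : Fin K) => (WithLp.toLp 2 fun p : ι × ι =>
        √(N : ℝ) * empCrossCov (fun n => ξ n ω) N ((k : ℕ) + 1) (φ p.1) (φ p.2) :
          EuclideanSpace ℝ (ι × ι)))
      atTop (id : (Fin K → EuclideanSpace ℝ (ι × ι)) → _) (fun _ => P)
      (Measure.pi fun _ : Fin K => multivariateGaussian 0 C) := by
  refine tendstoInDistribution_of_tendstoInMeasure_sub _ _
    (tendstoInDistribution_lagProd_sum hindep hident hφ hφ2 hφ0 K hC hCeq) ?_ fun N => ?_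
  · let R : Fin K → ι × ι → ℕ → Ω → ℝ := fun k p N ω =>
      √(N : ℝ) * empCrossCov (fun n => ξ n ω) N ((k : ℕ) + 1) (φ p.1) (φ p.2)
        - (√(N : ℝ))⁻¹ * ∑ n ∈ Finset.range N,
          φ p.1 (ξ n ω) * φ p.2 (ξ (n + ((k : ℕ) + 1)) ω)
    let D : ℕ → Ω → ℝ := fun N ω => ∑ k, ∑ p, |R k p N ω|
    have hRint {N : ℕ} (hN : K < N) (k : Fin K) (p : ι × ι) : Integrable (R k p N) P :=
      (integral_abs_sqrt_mul_empCrossCov_sub_le hindep hident hφ hφ2 hφ0 p.1 p.2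
        (Nat.succ_pos k) (lt_of_le_of_lt k.isLt hN) rfl rfl).1
    have hDlim : Tendsto (fun N => ∑ k, ∑ p, ∫ ω, |R k p N ω| ∂P) atTop (𝓝 0) := by
      rw [show (0 : ℝ) = ∑ _k : Fin K, ∑ _p : ι × ι, 0 by simp]
      exact tendsto_finsetSum _ fun k _ => tendsto_finsetSum _ fun p _ =>
        tendsto_integral_abs_sqrt_mul_empCrossCov_sub hindep hident hφ hφ2 hφ0 p.1 p.2
          (Nat.succ_pos k)
    rw [tendstoInMeasure_iff_measureReal_norm]
    intro ε hε
    refine squeeze_zero' (Eventually.of_forall fun N => measureReal_nonneg) ?_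
      (by simpa using hDlim.div_const ε)
    filter_upwards [eventually_gt_atTop K] with N hN
    have hDint : Integrable (D N) P := integrable_finsetSum _ fun k _ =>
      integrable_finsetSum _ fun p _ => (hRint hN k p).abs
    have hDval : ∫ ω, D N ω ∂P = ∑ k, ∑ p, ∫ ω, |R k p N ω| ∂P := by
      simp only [D]
      rw [integral_finsetSum _ fun k _ => integrable_finsetSum _ fun p _ => (hRint hN k p).abs]
      exact Finset.sum_congr rfl fun k _ => integral_finsetSum _ fun p _ => (hRint hN k p).abs
    have hD0 (ω : Ω) : 0 ≤ D N ω :=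
      Finset.sum_nonneg fun k _ => Finset.sum_nonneg fun p _ => abs_nonneg _
    have hmarkov := mul_meas_ge_le_integral_of_nonneg (ae_of_all P hD0) hDint ε
    rw [le_div_iff₀ hε, ← hDval, mul_comm]
    refine le_trans (mul_le_mul_of_nonneg_left (measureReal_mono fun ω hω => ?_) hε.le) hmarkov
    refine le_trans (show ε ≤ _ from hω) ?_
    simp only [Pi.sub_apply, Pi.zero_apply, sub_zero]
    refine (pi_norm_le_iff_of_nonneg (hD0 ω)).2 fun k => ?_
    calc _ = √(∑ p, R k p N ω ^ 2) := by
          rw [EuclideanSpace.norm_eq]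
          simp [R]
      _ ≤ ∑ p, |R k p N ω| := by
          refine Real.sqrt_le_iff.2 ⟨Finset.sum_nonneg fun p _ => abs_nonneg _, ?_⟩
          simp_rw [← sq_abs (R k _ N ω)]
          exact Finset.sum_sq_le_sq_sum_of_nonneg fun p _ => abs_nonneg _
      _ ≤ D N ω := Finset.single_le_sum (f := fun k => ∑ p, |R k p N ω|)
          (fun k _ => Finset.sum_nonneg fun p _ => abs_nonneg _) (Finset.mem_univ k)
  · refine aemeasurable_pi_lambda _ fun k => (WithLp.measurable_toLp 2 _).comp_aemeasurable
      (aemeasurable_pi_lambda _ fun p => AEMeasurable.const_mul ?_ _)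
    exact (measurable_empCrossCov (hφ p.1) (hφ p.2) N _).comp_aemeasurable
      (aemeasurable_pi_lambda _ fun n => (hident n).aemeasurable_fst)

/-- The limit theorem for centred functions which are normalized to have variance `1` or vanish
identically. -/
lemma tendstoInDistribution_empCorrVector_of_standardized {m : ℕ} {φ : Fin m → ℝ → ℝ}
    (hindep : iIndepFun ξ P) (hident : ∀ n, IdentDistrib (ξ n) (ξ 0) P P)
    (hφ : ∀ i, Measurable (φ i)) (hφ2 : ∀ i, MemLp (fun ω => φ i (ξ 0 ω)) 2 P)
    (hφ0 : ∀ i, ∫ ω, φ i (ξ 0 ω) ∂P = 0)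
    (hφ1 : ∀ i, φ i = 0 ∨ ∫ ω, φ i (ξ 0 ω) ^ 2 ∂P = 1) (K : ℕ)
    {C : Matrix (Fin m × Fin m) (Fin m × Fin m) ℝ}
    (hC : C.PosSemidef) (hCeq : ∀ p q, C p q =
      (∫ ω, φ p.1 (ξ 0 ω) * φ q.1 (ξ 0 ω) ∂P) * ∫ ω, φ p.2 (ξ 0 ω) * φ q.2 (ξ 0 ω) ∂P) :
    TendstoInDistribution
      (fun (N : ℕ) (ω : Ω) (k : Fin K) =>
        √(N : ℝ) • empCorrVector (fun n => ξ n ω) N ((k : ℕ) + 1) φ)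
      atTop (id : (Fin K → EuclideanSpace ℝ (Fin m × Fin m)) → _) (fun _ => P)
      (Measure.pi fun _ : Fin K => multivariateGaussian 0 C) := by
  classical
  have hξ : AEMeasurable (fun ω n => ξ n ω) P :=
    aemeasurable_pi_lambda _ fun n => (hident n).aemeasurable_fst
  -- The normalizing factors; the value `1` in the degenerate case is harmless, since the
  -- cross-covariance vanishes there.
  let V : ℕ → Ω → Fin m × Fin m → ℝ := fun N ω p =>
    if φ p.1 = 0 ∨ φ p.2 = 0 then 1
    else (empStdDev (fun n => ξ n ω) N (φ p.1) * empStdDev (fun n => ξ n ω) N (φ p.2))⁻¹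
  have hVm (N : ℕ) : AEMeasurable (V N) P := by
    refine aemeasurable_pi_lambda _ fun p => ?_
    simp only [V]
    split_ifs
    · fun_prop
    · exact (((measurable_empStdDev (hφ p.1) N).mul
        (measurable_empStdDev (hφ p.2) N)).inv).comp_aemeasurable hξ
  have hVlim : TendstoInMeasure P V atTop fun _ _ => 1 := by
    refine tendstoInMeasure_of_tendsto_ae (fun N => (hVm N).aestronglyMeasurable) ?_
    filter_upwards [ae_all_iff.2 fun i => ae_tendsto_empVar hindep hident (hφ i) (hφ2 i)] with ω hω
    refine tendsto_pi_nhds.2 fun p => ?_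
    by_cases h : φ p.1 = 0 ∨ φ p.2 = 0
    · simp [V, h]
    · have hstd {i : Fin m} (hi : φ i ≠ 0) :
          Tendsto (fun N => empStdDev (fun n => ξ n ω) N (φ i)) atTop (𝓝 1) := by
        simpa [empStdDev, (hφ1 i).resolve_left hi, hφ0] using (hω i).sqrt
      rw [not_or] at h
      simpa [V, h] using ((hstd h.1).mul (hstd h.2)).inv₀ (by simp)
  have hlim := (tendstoInDistribution_empCrossCov hindep hident hφ hφ2 hφ0 K hC
    hCeq).continuous_comp_prodMk_of_tendstoInMeasure_const
    (g := fun (x : (Fin K → EuclideanSpace ℝ (Fin m × Fin m)) × (Fin m × Fin m → ℝ)) (k : Fin K) =>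
      (WithLp.toLp 2 fun p => x.1 k p * x.2 p : EuclideanSpace ℝ (Fin m × Fin m)))
    (by fun_prop) hVlim hVm
  refine hlim.congr (fun N => ae_of_all _ fun ω => ?_) (ae_of_all _ fun x => ?_)
  · ext k p
    simp only [V, empCorrVector, PiLp.smul_apply, smul_eq_mul]
    split_ifs with h
    · rcases h with h | h <;> simp [empCrossCorr, empCrossCov, empMean, h]
    · rw [empCrossCorr, mul_assoc, div_eq_mul_inv]
  · ext k p
    simp

end Standardized

section Standardization

variable {Ω : Type*} [MeasurableSpace Ω] {P : Measure Ω}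

/-- The standardization `(f - E f(X)) / s(f)` of `f`; it is `0` if `s(f) = 0`. -/
noncomputable def standardize (X : Ω → ℝ) (P : Measure Ω) (f : ℝ → ℝ) (x : ℝ) : ℝ :=
  (f x - ∫ ω, f (X ω) ∂P) / stdDev X P f

lemma measurable_standardize (X : Ω → ℝ) (P : Measure Ω) {f : ℝ → ℝ} (hf : Measurable f) :
    Measurable (standardize X P f) :=
  (hf.sub_const _).div_const _

variable {X : Ω → ℝ} {f g : ℝ → ℝ}

lemma integral_standardize_mul_standardize :
    ∫ ω, standardize X P f (X ω) * standardize X P g (X ω) ∂P = crossCorr X P f g := by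
  simp only [standardize, div_mul_div_comm]
  rw [integral_div]
  rfl

lemma standardize_eq_zero_or (hf : MemLp (fun ω => f (X ω)) 2 P) :
    standardize X P f = 0 ∨ ∫ ω, standardize X P f (X ω) ^ 2 ∂P = 1 := by
  by_cases h : stdDev X P f = 0
  · left
    ext x
    simp [standardize, h]
  · right
    simp_rw [pow_two]
    rw [integral_standardize_mul_standardize, crossCorr, crossCov, covariance_self hf.aemeasurable]
    have hsq : stdDev X P f * stdDev X P f = Var[fun ω => f (X ω); P] :=
      Real.mul_self_sqrt (variance_nonneg _ _)
    rw [← hsq, div_self (mul_ne_zero h h)]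

variable [IsProbabilityMeasure P]

lemma memLp_standardize (hf : MemLp (fun ω => f (X ω)) 2 P) :
    MemLp (fun ω => standardize X P f (X ω)) 2 P := by
  simp only [standardize, div_eq_mul_inv]
  exact (hf.sub (memLp_const _)).mul_const _

lemma integral_standardize (hf : MemLp (fun ω => f (X ω)) 2 P) :
    ∫ ω, standardize X P f (X ω) ∂P = 0 := by
  simp only [standardize]
  rw [integral_div, integral_sub (hf.integrable one_le_two) (integrable_const _)]
  simp

/-- This includes the degenerate case, in which `f(X)` is almost surely constant. -/
lemma ae_eq_add_stdDev_mul_standardize (hf : MemLp (fun ω => f (X ω)) 2 P) :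
    ∀ᵐ ω ∂P, f (X ω) = (∫ ω, f (X ω) ∂P) + stdDev X P f * standardize X P f (X ω) := by
  by_cases h : stdDev X P f = 0
  · have hvar : Var[fun ω => f (X ω); P] = 0 :=
      (Real.sqrt_eq_zero (variance_nonneg _ _)).1 h
    filter_upwards [ae_eq_integral_of_variance_eq_zero hf hvar] with ω hω
    simp [hω, h]
  · refine ae_of_all _ fun ω => ?_
    rw [standardize, mul_div_cancel₀ _ h, add_sub_cancel]

/-- The matrix `limitCorrMatrix` is the Kronecker square of the correlation matrix, which is the
Gram matrix of the standardized functions. -/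
lemma posSemidef_limitCorrMatrix {m : ℕ} {f : Fin m → ℝ → ℝ}
    (hf : ∀ i, MemLp (fun ω => f i (X ω)) 2 P) : (limitCorrMatrix X P f).PosSemidef := by
  have h := posSemidef_integral_mul fun i => memLp_standardize (hf i)
  simp_rw [integral_standardize_mul_standardize] at h
  exact h.kronecker h

end Standardization

lemma memLp_two_of_integrable_pow_four {Ω : Type*} [MeasurableSpace Ω] {P : Measure Ω}
    [IsFiniteMeasure P] {Y : Ω → ℝ} (hY : AEStronglyMeasurable Y P)
    (h : Integrable (fun ω => Y ω ^ 4) P) : MemLp Y 2 P := by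
  rw [memLp_two_iff_integrable_sq hY]
  refine ((integrable_const (1 : ℝ)).add h).mono' (hY.pow 2) (ae_of_all _ fun ω => ?_)
  simp only [Pi.add_apply, Real.norm_eq_abs, abs_pow, sq_abs]
  nlinarith [sq_nonneg (Y ω ^ 2 - 1), sq_nonneg (Y ω)]

end IIDTest

open IIDTest in
theorem theorem2
    {Ω Ω' : Type*} [MeasurableSpace Ω] [MeasurableSpace Ω']
    (P : Measure Ω) [IsProbabilityMeasure P] (P' : Measure Ω') [IsProbabilityMeasure P']
    (ξ : ℕ → Ω → ℝ) (X : Ω' → ℝ)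
    (h_indep : iIndepFun ξ P) (h_ident : ∀ n, IdentDistrib (ξ n) X P P')
    (m K : ℕ) (f : Fin m → ℝ → ℝ) (hf : ∀ i, Measurable (f i))
    (h_fourth : ∀ i, Integrable (fun ω => (f i (X ω)) ^ 4) P') :
    (IIDTest.limitCorrMatrix X P' f).PosSemidef ∧
    TendstoInDistribution
      (fun (N : ℕ) (ω : Ω) (k : Fin K) =>
        √(N : ℝ) • IIDTest.empCorrVector (fun n => ξ n ω) N ((k : ℕ) + 1) f)
      atTop
      (id : (Fin K → EuclideanSpace ℝ (Fin m × Fin m)) → _)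
      (fun _ => P)
      (Measure.pi fun _ : Fin K => multivariateGaussian 0 (IIDTest.limitCorrMatrix X P' f)) := by
  have hX : AEMeasurable X P' := (h_ident 0).aemeasurable_snd
  have hL2 (i : Fin m) : MemLp (fun ω => f i (X ω)) 2 P' :=
    memLp_two_of_integrable_pow_four ((hf i).comp_aemeasurable hX).aestronglyMeasurable
      (h_fourth i)
  have hC := posSemidef_limitCorrMatrix hL2
  refine ⟨hC, ?_⟩
  let φ : Fin m → ℝ → ℝ := fun i => standardize X P' (f i)
  have hφ (i : Fin m) : Measurable (φ i) := measurable_standardize X P' (hf i)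
  have hlim := tendstoInDistribution_empCorrVector_of_standardized (φ := φ) h_indep
    (fun n => (h_ident n).trans (h_ident 0).symm) hφ
    (fun i => ((h_ident 0).comp (hφ i)).memLp_iff.2 (memLp_standardize (hL2 i)))
    (fun i => ((h_ident 0).comp (hφ i)).integral_eq.trans (integral_standardize (hL2 i)))
    (fun i => (standardize_eq_zero_or (hL2 i)).imp_right
      ((h_ident 0).comp ((hφ i).pow_const 2)).integral_eq.trans) K hC
    (fun p q => congrArg₂ (· * ·)
      (integral_standardize_mul_standardize.symm.trans
        ((h_ident 0).comp ((hφ p.1).mul (hφ q.1))).integral_eq.symm)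
      (integral_standardize_mul_standardize.symm.trans
        ((h_ident 0).comp ((hφ p.2).mul (hφ q.2))).integral_eq.symm))
  refine hlim.congr (fun N => ?_) EventuallyEq.rfl
  have hae : ∀ᵐ ω ∂P, ∀ i n, f i (ξ n ω) =
      (∫ ω, f i (X ω) ∂P') + stdDev X P' (f i) * φ i (ξ n ω) := by
    refine ae_all_iff.2 fun i => ae_all_iff.2 fun n => ?_
    exact (h_ident n).symm.ae_snd
      (p := fun x => f i x = (∫ ω, f i (X ω) ∂P') + stdDev X P' (f i) * φ i x)
      (measurableSet_eq_fun (hf i) (((hφ i).const_mul _).const_add _))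
      (ae_eq_add_stdDev_mul_standardize (hL2 i))
  filter_upwards [hae] with ω hω
  ext k p
  simp only [empCorrVector, PiLp.smul_apply, smul_eq_mul]
  rw [empCrossCorr_eq_of_affine (Real.sqrt_nonneg _) (Real.sqrt_nonneg _) (hω p.1) (hω p.2)
    (fun h n => by simp only [φ, standardize, stdDev, h, div_zero])
    (fun h n => by simp only [φ, standardize, stdDev, h, div_zero])]
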